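/- A tiling of $\mathbb{R}^d$ is a countable collection of full-dimensional compact convex polytopes (the tiles) that covers $\mathbb{R}^d$ and in which distinct tiles have disjoint interiors. It is face-to-face if the intersection of any two tiles is a (possibly empty) face of both. A vertex of the tiling is a point that is a vertex of at least one tile, and the vertex-corona of a vertex $x$ is $x$ together with the set of all tiles containing $x$. The tiling is monocoronal (up to congruence) if for any two of its vertices there is a map $y\mapsto t+Ry$ with $t\in\mathbb{R}^d$, $R\in O(d)$ carrying one vertex-corona to the other (vertex to vertex, set of tiles to set of tiles); it is monocoronal up to rigid motions if $R$ can always be chosen in $SO(d)$. The tiling is $k$-periodic if the maximal number of linearly independent vectors $v\in\mathbb{R}^d$ such that the translation by $v$ maps the tiling to itself is exactly $k$. **Theorem.** Let $d\ge 1$. 1. There is a face-to-face tiling of $\mathbb{R}^d$ that is monocoronal (up to congruence) and $\lceil \frac d2\rceil$-periodic. 2. There is a face-to-face tiling of $\mathbb{R}^d$ that is monocoronal up to rigid motions and $\lceil \frac{d+1}2\rceil$-periodic. -/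

import Mathlib

namespace MonoTiling

/-- Euclidean space `ℝ^d` with its Euclidean norm. -/
abbrev Space (d : ℕ) : Type := EuclideanSpace ℝ (Fin d)

/-- A full-dimensional convex polytope: the convex hull of finitely many points, with nonempty
interior. -/
def IsConvexPolytope {d : ℕ} (P : Set (Space d)) : Prop :=
  (∃ s : Set (Space d), s.Finite ∧ P = convexHull ℝ s) ∧ (interior P).Nonempty

/-- A tiling of `ℝ^d` by convex polytopes: a countable collection of tiles that is a covering and
a packing. -/
structure IsTiling {d : ℕ} (𝒯 : Set (Set (Space d))) : Prop where
  countable : 𝒯.Countable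
  isCompact : ∀ T ∈ 𝒯, IsCompact T
  polytope : ∀ T ∈ 𝒯, IsConvexPolytope T
  covers : ⋃₀ 𝒯 = Set.univ
  packing : ∀ S ∈ 𝒯, ∀ T ∈ 𝒯, S ≠ T → interior S ∩ interior T = ∅

/-- The vertices of a tiling are the vertices (extreme points) of its tiles. -/
def IsVertex {d : ℕ} (𝒯 : Set (Set (Space d))) (x : Space d) : Prop :=
  ∃ T ∈ 𝒯, x ∈ T.extremePoints ℝ

/-- The intersection of any two tiles is a face of both. The faces of a convex polytope are its
exposed subsets; for `IsExposed`, the empty set and the whole polytope count as faces. -/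
def IsFaceToFace {d : ℕ} (𝒯 : Set (Set (Space d))) : Prop :=
  ∀ S ∈ 𝒯, ∀ T ∈ 𝒯, IsExposed ℝ S (S ∩ T) ∧ IsExposed ℝ T (S ∩ T)

/-- The vertex-corona of `x`: the point `x` together with the set of all tiles containing `x`. -/
def vertexCorona {d : ℕ} (𝒯 : Set (Set (Space d))) (x : Space d) :
    Space d × Set (Set (Space d)) :=
  (x, {T | T ∈ 𝒯 ∧ x ∈ T})

/-- The image of a pointed collection of sets under the isometry `y ↦ t + R y`. -/
noncomputable def moveCorona {d : ℕ} (t : Space d) (R : Space d ≃ₗᵢ[ℝ] Space d)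
    (C : Space d × Set (Set (Space d))) : Space d × Set (Set (Space d)) :=
  (t + R C.1, (fun T : Set (Space d) => (fun y => t + R y) '' T) '' C.2)

/-- Congruence, mirror images allowed (`R ∈ O(d)`). -/
def Congruent {d : ℕ} (C C' : Space d × Set (Set (Space d))) : Prop :=
  ∃ (t : Space d) (R : Space d ≃ₗᵢ[ℝ] Space d), C = moveCorona t R C'

/-- Direct congruence, mirror images forbidden (`R ∈ SO(d)`). -/
def DirectlyCongruent {d : ℕ} (C C' : Space d × Set (Set (Space d))) : Prop :=
  ∃ (t : Space d) (R : Space d ≃ₗᵢ[ℝ] Space d),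
    LinearMap.det (R.toLinearEquiv : Space d →ₗ[ℝ] Space d) = 1 ∧ C = moveCorona t R C'

/-- Monocoronal up to congruence. -/
def IsMonocoronal {d : ℕ} (𝒯 : Set (Set (Space d))) : Prop :=
  ∀ x y : Space d, IsVertex 𝒯 x → IsVertex 𝒯 y →
    Congruent (vertexCorona 𝒯 x) (vertexCorona 𝒯 y)

/-- Monocoronal up to rigid motions. -/
def IsMonocoronalRigid {d : ℕ} (𝒯 : Set (Set (Space d))) : Prop :=
  ∀ x y : Space d, IsVertex 𝒯 x → IsVertex 𝒯 y →
    DirectlyCongruent (vertexCorona 𝒯 x) (vertexCorona 𝒯 y)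

/-- `φ` is a symmetry of the tiling: it maps the collection of tiles onto itself. The symmetry
group consists of all isometries `φ` of `ℝ^d` with this property. -/
def IsSymmetry {d : ℕ} (𝒯 : Set (Set (Space d))) (φ : Space d ≃ᵢ Space d) : Prop :=
  (fun T : Set (Space d) => φ '' T) '' 𝒯 = 𝒯

/-- The vectors `v` for which the translation `x ↦ v + x` belongs to the symmetry group. -/
def translationVectors {d : ℕ} (𝒯 : Set (Set (Space d))) : Set (Space d) :=
  {v | IsSymmetry 𝒯 (IsometryEquiv.addLeft v)}

/-- `k`-periodic: the maximal number of linearly independent translations in the symmetry group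
is exactly `k`. -/
def IsPeriodic {d : ℕ} (k : ℕ) (𝒯 : Set (Set (Space d))) : Prop :=
  Module.finrank ℝ (Submodule.span ℝ (translationVectors 𝒯)) = k

end MonoTiling

namespace MonoTiling

/-! ### A piecewise linear profile -/

/-! Start from the unit cube tiling and shear each coordinate in `S` by a piecewise linear function
`ramp` of an unsheared partner coordinate. Shears are affine on each cube, so the tiles are
parallelepipeds that still meet face-to-face.

The profile is flat on every other unit interval and has slope ±1 on the rest. Hence near any
integer it is `max u 0` up to reflecting the argument and the value (`exists_local_ramp`).
Reflecting coordinate axes therefore carries one fixed `refCorona` to every vertex corona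
(`vertexCorona_eq_moveCorona`). A free coordinate, neither sheared nor a partner, can be reflected
at will to make the determinant 1.

The slope changes sign only once, so the profile has no period, and translations have zero component
along every partner axis; all other axes are periods. With `k` disjoint pairs this leaves `d - k`
periods, and `k` is taken as large as possible: `2 * k ≤ d`, or `2 * k < d` if a free coordinate is
needed. -/

/-- The values at the integers of the shear profile: its slope vanishes on the intervals
`[2m, 2m+1]`, is `1` on the other intervals to the right of `1` and `-1` on the other intervals to
the left of `0`. -/
def height (j : ℤ) : ℤ := (j / 2).natAbs

/-- The slope of the shear profile on `[j, j + 1]`. -/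
def slope (j : ℤ) : ℤ := height (j + 1) - height j

/-- The piecewise linear interpolation of `height`. -/
noncomputable def ramp (y : ℝ) : ℝ := height ⌊y⌋ + slope ⌊y⌋ * Int.fract y

theorem ramp_eq_of_mem_Icc {j : ℤ} {y : ℝ} (h₀ : (j : ℝ) ≤ y) (h₁ : y ≤ j + 1) :
    ramp y = height j + slope j * (y - j) := by
  rcases h₁.lt_or_eq with h | rfl
  · have : ⌊y⌋ = j := Int.floor_eq_iff.2 ⟨h₀, h⟩
    rw [ramp, Int.fract, this]
  · have : ⌊(j : ℝ) + 1⌋ = j + 1 := by simp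
    rw [ramp, Int.fract, this]
    simp only [slope]
    push_cast
    ring

theorem ramp_intCast (j : ℤ) : ramp j = height j := by
  simp [ramp]

/-- At every integer one of the two adjacent slopes is `0` and the other one is `±1`. -/
theorem exists_local_ramp (j : ℤ) :
    ∃ ε ρ : ℤˣ, ∀ u : ℝ, |u| ≤ 1 →
      ramp (j + ((ρ : ℤ) : ℝ) * u) = ramp j + ((ε : ℤ) : ℝ) * max u 0 := by
  have right (u : ℝ) (h₀ : 0 ≤ u) (h₁ : u ≤ 1) : ramp (j + u) = ramp j + slope j * u := by
    rw [ramp_eq_of_mem_Icc (j := j) (by linarith) (by linarith), ramp_intCast]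
    ring
  have left (u : ℝ) (h₀ : 0 ≤ u) (h₁ : u ≤ 1) :
      ramp (j - u) = ramp j - slope (j - 1) * u := by
    rw [ramp_eq_of_mem_Icc (j := j - 1) (by push_cast; linarith) (by push_cast; linarith),
      ramp_intCast]
    simp only [slope, sub_add_cancel]
    push_cast
    ring
  have slopes : (slope j = 0 ∧ IsUnit (slope (j - 1))) ∨
      (slope (j - 1) = 0 ∧ IsUnit (slope j)) := by
    simp only [Int.isUnit_iff, slope, height, sub_add_cancel]
    omega
  rcases slopes with ⟨h, ε, hε⟩ | ⟨h, ε, hε⟩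
  -- The sloped side is the left one; walking leftwards reverses the sign of the slope.
  · refine ⟨-ε, -1, fun u hu => ?_⟩
    obtain ⟨h₁, h₂⟩ := abs_le.1 hu
    rcases le_total 0 u with hu₀ | hu₀
    · have := left u hu₀ h₂
      rw [max_eq_left hu₀]
      push_cast
      rw [hε, neg_one_mul, ← sub_eq_add_neg, this]
      ring
    · have := right (-u) (by linarith) (by linarith)
      rw [max_eq_right hu₀]
      push_cast
      rw [neg_one_mul, this, h]
      simp
  · refine ⟨ε, 1, fun u hu => ?_⟩
    obtain ⟨h₁, h₂⟩ := abs_le.1 hu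
    rcases le_total 0 u with hu₀ | hu₀
    · have := right u hu₀ h₂
      rw [max_eq_left hu₀]
      push_cast
      rw [hε, one_mul, this]
    · have := left (-u) (by linarith) (by linarith)
      rw [max_eq_right hu₀]
      push_cast
      rw [one_mul, ← sub_neg_eq_add, this, h]
      simp

/-- The sequence of slopes has no nontrivial period. -/
theorem eq_zero_of_slope_periodic {v : ℤ} (h : ∀ j, slope (j + v) = slope j) : v = 0 := by
  -- Slope 1 occurs only to the right and forces `0 ≤ v`; slope -1 occurs only to the left and
  -- forces `v ≤ 0`.
  have h₁ := h 1
  have h₂ := h (-1)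
  simp only [slope, height] at h₁ h₂
  omega

/-! ### The sheared cubical tiling -/

section Sheared

variable {d : ℕ} (S : Finset (Fin d)) (p : Fin d → Fin d)

/-- Cubical coordinates on `ℝ^d`: the coordinates in `S` are sheared along the profile of their
partner coordinates. -/
noncomputable def cubeCoord (x : Space d) (i : Fin d) : ℝ :=
  x i - if i ∈ S then ramp (x (p i)) else 0

/-- The inverse of `cubeCoord`. -/
noncomputable def ofCubeCoord (w : Fin d → ℝ) : Space d :=
  WithLp.toLp 2 fun i => w i + if i ∈ S then ramp (w (p i)) else 0

/-- The tile given by the unit cube with smallest corner `n` in cubical coordinates. -/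
def tile (n : Fin d → ℤ) : Set (Space d) :=
  {x | ∀ i, (n i : ℝ) ≤ cubeCoord S p x i ∧ cubeCoord S p x i ≤ n i + 1}

/-- The tiling by cubes in cubical coordinates. -/
def shearedTiling : Set (Set (Space d)) := Set.range (tile S p)

/-- The affine map that agrees with `ofCubeCoord` on the unit cube with smallest corner `n`. -/
noncomputable def cellMap (n : Fin d → ℤ) : (Fin d → ℝ) →ᵃ[ℝ] Space d where
  toFun w := WithLp.toLp 2 fun i =>
    w i + if i ∈ S then (height (n (p i)) : ℝ) + slope (n (p i)) * (w (p i) - n (p i)) else 0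
  linear :=
    { toFun := fun w => WithLp.toLp 2 fun i =>
        w i + if i ∈ S then (slope (n (p i)) : ℝ) * w (p i) else 0
      map_add' := fun v w => by
        ext i
        by_cases hi : i ∈ S <;> simp [hi]
        ring
      map_smul' := fun c w => by
        ext i
        by_cases hi : i ∈ S <;> simp [hi]
        ring }
  map_vadd' v w := by
    ext i
    by_cases hi : i ∈ S <;> simp [hi]
    ring

/-- The linear functional that agrees with `cubeCoord · i` on `tile n`, up to a constant. -/
noncomputable def cellCoord (n : Fin d → ℤ) (i : Fin d) : Space d →L[ℝ] ℝ :=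
  EuclideanSpace.proj i - if i ∈ S then (slope (n (p i)) : ℝ) • EuclideanSpace.proj (p i) else 0

variable {S p}

theorem cubeCoord_of_notMem {i : Fin d} (hi : i ∉ S) (x : Space d) :
    cubeCoord S p x i = x i := by
  simp [cubeCoord, hi]

theorem cubeCoord_ofCubeCoord (hp : ∀ i ∈ S, p i ∉ S) (w : Fin d → ℝ) :
    cubeCoord S p (ofCubeCoord S p w) = w := by
  ext i
  by_cases hi : i ∈ S
  · simp [cubeCoord, ofCubeCoord, hi, hp i hi]
  · simp [cubeCoord, ofCubeCoord, hi]

theorem ofCubeCoord_cubeCoord (hp : ∀ i ∈ S, p i ∉ S) (x : Space d) :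
    ofCubeCoord S p (cubeCoord S p x) = x := by
  ext i
  by_cases hi : i ∈ S
  · simp [cubeCoord, ofCubeCoord, hi, hp i hi]
  · simp [cubeCoord, ofCubeCoord, hi]

theorem cellMap_apply {n : Fin d → ℤ} {w : Fin d → ℝ}
    (hw : ∀ i, (n i : ℝ) ≤ w i ∧ w i ≤ n i + 1) : cellMap S p n w = ofCubeCoord S p w := by
  ext i
  by_cases hi : i ∈ S
  · simp [cellMap, ofCubeCoord, hi, ramp_eq_of_mem_Icc (hw (p i)).1 (hw (p i)).2]
  · simp [cellMap, ofCubeCoord, hi]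

/-- Partners are unsheared, so bounds on the unsheared coordinates alone already select the affine
piece of each profile. -/
theorem cubeCoord_eq_cellCoord (hp : ∀ i ∈ S, p i ∉ S) {n : Fin d → ℤ} {x y : Space d}
    (hx : ∀ j ∉ S, (n j : ℝ) ≤ x j ∧ x j ≤ n j + 1)
    (hy : ∀ j ∉ S, (n j : ℝ) ≤ y j ∧ y j ≤ n j + 1) (i : Fin d) :
    cubeCoord S p x i - cubeCoord S p y i = cellCoord S p n i x - cellCoord S p n i y := by
  by_cases hi : i ∈ S
  · have h₁ := hx (p i) (hp i hi)
    have h₂ := hy (p i) (hp i hi)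
    simp only [cubeCoord, cellCoord, hi, if_true]
    rw [ramp_eq_of_mem_Icc h₁.1 h₁.2, ramp_eq_of_mem_Icc h₂.1 h₂.2]
    simp
    ring
  · simp [cubeCoord, cellCoord, hi]

theorem tile_eq_image (hp : ∀ i ∈ S, p i ∉ S) (n : Fin d → ℤ) :
    tile S p n = cellMap S p n '' Set.univ.pi fun i => Set.Icc (n i : ℝ) (n i + 1) := by
  ext x
  constructor
  · intro hx
    refine ⟨cubeCoord S p x, fun i _ => hx i, ?_⟩
    rw [cellMap_apply hx, ofCubeCoord_cubeCoord hp]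
  · rintro ⟨w, hw, rfl⟩
    have hw' i := hw i (Set.mem_univ i)
    rw [cellMap_apply hw']
    intro i
    rw [cubeCoord_ofCubeCoord hp]
    exact hw' i

theorem tile_eq_convexHull (hp : ∀ i ∈ S, p i ∉ S) (n : Fin d → ℤ) :
    tile S p n = convexHull ℝ (cellMap S p n ''
      Set.univ.pi fun i => ({(n i : ℝ), (n i : ℝ) + 1} : Set ℝ)) := by
  rw [← AffineMap.image_convexHull, convexHull_pi, tile_eq_image hp]
  have (a : ℤ) : Set.Icc (a : ℝ) (a + 1) = convexHull ℝ {(a : ℝ), (a : ℝ) + 1} := by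
    rw [convexHull_pair, segment_eq_Icc (by linarith)]
  simp only [this]

theorem finite_cellMap_image (n : Fin d → ℤ) : (cellMap S p n ''
    Set.univ.pi fun i => ({(n i : ℝ), (n i : ℝ) + 1} : Set ℝ)).Finite :=
  (Set.Finite.pi fun _ => Set.toFinite _).image _

theorem exists_cubeCoord_eq_of_isVertex (hp : ∀ i ∈ S, p i ∉ S) {x : Space d}
    (hx : IsVertex (shearedTiling S p) x) : ∃ z : Fin d → ℤ, ∀ i, cubeCoord S p x i = z i := by
  obtain ⟨_, ⟨n, rfl⟩, hx⟩ := hx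
  rw [tile_eq_convexHull hp] at hx
  obtain ⟨w, hw, rfl⟩ := extremePoints_convexHull_subset hx
  have hw' (i : Fin d) : w i = n i ∨ w i = n i + 1 := by simpa using hw i (Set.mem_univ i)
  rw [cellMap_apply fun i => by rcases hw' i with h | h <;> rw [h] <;> simp,
    cubeCoord_ofCubeCoord hp]
  have (i : Fin d) : ∃ z : ℤ, w i = z := by
    rcases hw' i with h | h
    · exact ⟨n i, h⟩
    · exact ⟨n i + 1, by rw [h]; simp⟩
  exact Classical.skolem.1 this

theorem mem_Icc_of_mem_tile {n : Fin d → ℤ} {x : Space d} (hx : x ∈ tile S p n) :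
    ∀ j ∉ S, (n j : ℝ) ≤ x j ∧ x j ≤ n j + 1 := fun j hj => by
  simpa only [cubeCoord_of_notMem hj] using hx j

theorem interior_tile_nonempty (hp : ∀ i ∈ S, p i ∉ S) (n : Fin d → ℤ) :
    (interior (tile S p n)).Nonempty := by
  set c : Space d := ofCubeCoord S p fun i => n i + 1 / 2 with hc
  have hcoord (i) : cubeCoord S p c i = n i + 1 / 2 := by rw [hc, cubeCoord_ofCubeCoord hp]
  have hbox : ∀ j ∉ S, (n j : ℝ) ≤ c j ∧ c j ≤ n j + 1 := fun j hj => by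
    rw [← cubeCoord_of_notMem hj (p := p), hcoord]
    constructor <;> linarith
  have hopen : IsOpen {x : Space d | ∀ i, |cellCoord S p n i x - cellCoord S p n i c| < 1 / 2} := by
    rw [show {x : Space d | ∀ i, |cellCoord S p n i x - cellCoord S p n i c| < 1 / 2} =
      ⋂ i, {x | |cellCoord S p n i x - cellCoord S p n i c| < 1 / 2} by ext; simp]
    exact isOpen_iInter_of_finite fun i => isOpen_lt (by fun_prop) continuous_const
  refine ⟨c, interior_maximal ?_ hopen (by simp)⟩
  intro x hx
  -- The unsheared bounds come first: they make the linear formula available for the sheared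
  -- coordinates.
  have hx' : ∀ j ∉ S, (n j : ℝ) ≤ x j ∧ x j ≤ n j + 1 := fun j hj => by
    have h₁ := abs_lt.1 (hx j)
    have h₂ := hcoord j
    rw [cubeCoord_of_notMem hj] at h₂
    simp only [cellCoord, hj, if_false, sub_zero, PiLp.proj_apply] at h₁
    constructor <;> linarith
  intro i
  have h₁ := abs_lt.1 (hx i)
  have h₂ := cubeCoord_eq_cellCoord hp hx' hbox i
  rw [hcoord] at h₂
  constructor <;> linarith

theorem cubeCoord_add_single_same (hp : ∀ i ∈ S, p i ∉ S) (x : Space d) (i : Fin d) (t : ℝ) :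
    cubeCoord S p (x + EuclideanSpace.single i t) i = cubeCoord S p x i + t := by
  by_cases hi : i ∈ S
  · have : p i ≠ i := fun h => hp i hi (h.symm ▸ hi)
    simp [cubeCoord, hi, this]
    ring
  · simp [cubeCoord, hi]

theorem cubeCoord_add_single (x : Space d) {i : Fin d} (t : ℝ) (hi : ∀ j ∈ S, p j ≠ i)
    (j : Fin d) :
    cubeCoord S p (x + EuclideanSpace.single i t) j =
      cubeCoord S p x j + if j = i then t else 0 := by
  by_cases hj : j ∈ S
  · simp [cubeCoord, hj, hi j hj]
    ring
  · simp [cubeCoord, hj]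

/-- An interior point can move both ways along axis `i`, which shifts its `i`-th cubical coordinate
by the same amount. -/
theorem lt_cubeCoord_lt_of_mem_interior (hp : ∀ i ∈ S, p i ∉ S) {n : Fin d → ℤ} {x : Space d}
    (hx : x ∈ interior (tile S p n)) (i : Fin d) :
    (n i : ℝ) < cubeCoord S p x i ∧ cubeCoord S p x i < n i + 1 := by
  have hc : Continuous fun t : ℝ => x + EuclideanSpace.single i t := by
    have : (fun t : ℝ => x + EuclideanSpace.single i t) =
        fun t : ℝ => x + t • EuclideanSpace.single i (1 : ℝ) := by
      ext t j
      by_cases hj : j = i <;> simp [hj]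
    rw [this]
    fun_prop
  have hzero : x + EuclideanSpace.single i (0 : ℝ) = x := by
    ext j
    by_cases hj : j = i <;> simp [hj]
  have h₀ : (fun t : ℝ => x + EuclideanSpace.single i t) ⁻¹' interior (tile S p n) ∈ nhds 0 :=
    (isOpen_interior.preimage hc).mem_nhds (by rwa [Set.mem_preimage, hzero])
  obtain ⟨ε, hε, hball⟩ := Metric.mem_nhds_iff.1 h₀
  have hmem (t : ℝ) (ht : |t| < ε) :
      (n i : ℝ) ≤ cubeCoord S p x i + t ∧ cubeCoord S p x i + t ≤ n i + 1 := by
    have := interior_subset (hball (show t ∈ Metric.ball 0 ε by simpa using ht)) i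
    rwa [cubeCoord_add_single_same hp] at this
  have h₁ := hmem (ε / 2) (by rw [abs_of_pos (by linarith)]; linarith)
  have h₂ := hmem (-(ε / 2)) (by rw [abs_neg, abs_of_pos (by linarith)]; linarith)
  constructor <;> linarith

theorem isTiling_shearedTiling (hp : ∀ i ∈ S, p i ∉ S) : IsTiling (shearedTiling S p) where
  countable := Set.countable_range _
  isCompact := by
    rintro _ ⟨n, rfl⟩
    rw [tile_eq_convexHull hp]
    exact (finite_cellMap_image n).isCompact_convexHull ℝ
  polytope := by
    rintro _ ⟨n, rfl⟩
    exact ⟨⟨_, finite_cellMap_image n, tile_eq_convexHull hp n⟩, interior_tile_nonempty hp n⟩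
  covers := Set.eq_univ_of_forall fun x =>
    ⟨_, ⟨fun i => ⌊cubeCoord S p x i⌋, rfl⟩,
      fun i => ⟨Int.floor_le _, (Int.lt_floor_add_one _).le⟩⟩
  packing := by
    rintro _ ⟨n, rfl⟩ _ ⟨m, rfl⟩ hne
    by_contra hinter
    obtain ⟨x, hn, hm⟩ := Set.nonempty_iff_ne_empty.2 hinter
    refine hne (congrArg _ (funext fun i => ?_))
    obtain ⟨h₁, h₂⟩ := lt_cubeCoord_lt_of_mem_interior hp hn i
    obtain ⟨h₃, h₄⟩ := lt_cubeCoord_lt_of_mem_interior hp hm i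
    rw [← Int.floor_eq_iff.2 ⟨h₁.le, h₂⟩, ← Int.floor_eq_iff.2 ⟨h₃.le, h₄⟩]

/-- Corners of touching cubes differ by -1, 0 or 1 in each coordinate. Weighting the cell
functionals by these differences gives a functional maximal on the first tile exactly along the
common face. -/
theorem isExposed_tile_inter_tile (hp : ∀ i ∈ S, p i ∉ S) (n m : Fin d → ℤ) :
    IsExposed ℝ (tile S p n) (tile S p n ∩ tile S p m) := by
  rintro ⟨z, hzn, hzm⟩
  have hcell {x} (hx : x ∈ tile S p n) (i) := cubeCoord_eq_cellCoord hp
    (mem_Icc_of_mem_tile hx) (mem_Icc_of_mem_tile hzn) i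
  have hcases (i) : m i = n i - 1 ∨ m i = n i ∨ m i = n i + 1 := by
    have h₁ : (n i : ℝ) ≤ m i + 1 := (hzn i).1.trans (hzm i).2
    have h₂ : (m i : ℝ) ≤ n i + 1 := (hzm i).1.trans (hzn i).2
    norm_cast at h₁ h₂
    omega
  have hle {x} (hx : x ∈ tile S p n) (i) : ((m i - n i : ℤ) : ℝ) * cellCoord S p n i x ≤
      ((m i - n i : ℤ) : ℝ) * cellCoord S p n i z := by
    have h₀ := hcell hx i
    have h₁ := hx i
    have h₂ := hzm i
    have h₃ := hzn i
    rcases hcases i with h | h | h <;> rw [h] at h₂ ⊢ <;> push_cast at h₂ ⊢ <;> linarith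
  have heq {x} (hx : x ∈ tile S p n) (hxm : x ∈ tile S p m) (i) :
      ((m i - n i : ℤ) : ℝ) * cellCoord S p n i x =
        ((m i - n i : ℤ) : ℝ) * cellCoord S p n i z := by
    have h₀ := hcell hx i
    have h₁ := hx i
    have h₂ := hzm i
    have h₃ := hzn i
    have h₄ := hxm i
    rcases hcases i with h | h | h <;> rw [h] at h₂ h₄ ⊢ <;> push_cast at h₂ h₄ ⊢ <;> linarith
  let l : Space d →L[ℝ] ℝ := ∑ i, ((m i - n i : ℤ) : ℝ) • cellCoord S p n i
  have hl (x) : l x = ∑ i, ((m i - n i : ℤ) : ℝ) * cellCoord S p n i x := by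
    simp only [l, _root_.sum_apply, _root_.smul_apply, smul_eq_mul]
  refine ⟨l, Set.ext fun x => ⟨fun ⟨hx, hxm⟩ => ⟨hx, fun y hy => ?_⟩, fun ⟨hx, hmax⟩ => ⟨hx, ?_⟩⟩⟩
  · rw [hl, hl]
    exact Finset.sum_le_sum fun i _ => (hle hy i).trans_eq (heq hx hxm i).symm
  · have hz := hmax z hzn
    rw [hl, hl] at hz
    -- The common point `z` maximizes every summand at once, so a maximizer of the sum does too.
    have hterm := (Finset.sum_eq_sum_iff_of_le fun i _ => hle hx i).1
      (le_antisymm (Finset.sum_le_sum fun i _ => hle hx i) hz)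
    intro i
    have h₀ := hcell hx i
    have h₁ := hx i
    have h₂ := hzm i
    have h₃ := hzn i
    have h₄ := hterm i (Finset.mem_univ i)
    rcases hcases i with h | h | h <;> rw [h] at h₂ h₄ ⊢ <;> push_cast at h₂ h₄ ⊢ <;>
      constructor <;> linarith

theorem isFaceToFace_shearedTiling (hp : ∀ i ∈ S, p i ∉ S) :
    IsFaceToFace (shearedTiling S p) := by
  rintro _ ⟨n, rfl⟩ _ ⟨m, rfl⟩
  refine ⟨isExposed_tile_inter_tile hp n m, ?_⟩
  rw [Set.inter_comm]
  exact isExposed_tile_inter_tile hp m n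

/-! ### Vertex coronas -/

/-- The isometry changing the signs of the coordinates according to `σ`. -/
noncomputable def signIsometry (σ : Fin d → ℤˣ) : Space d ≃ₗᵢ[ℝ] Space d where
  toFun w := WithLp.toLp 2 fun i => ((σ i : ℤ) : ℝ) * w i
  invFun w := WithLp.toLp 2 fun i => ((σ i : ℤ) : ℝ) * w i
  map_add' v w := by
    ext i
    simp [mul_add]
  map_smul' c w := by
    ext i
    simp
    ring
  left_inv w := by
    ext i
    rcases Int.units_eq_one_or (σ i) with h | h <;> simp [h]
  right_inv w := by
    ext i
    rcases Int.units_eq_one_or (σ i) with h | h <;> simp [h]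
  norm_map' w := by
    simp only [EuclideanSpace.norm_eq]
    congr! 3 with i
    rcases Int.units_eq_one_or (σ i) with h | h <;> simp [h]

theorem signIsometry_apply (σ : Fin d → ℤˣ) (w : Space d) (i : Fin d) :
    signIsometry σ w i = ((σ i : ℤ) : ℝ) * w i := rfl

theorem signIsometry_signIsometry (σ : Fin d → ℤˣ) (w : Space d) :
    signIsometry σ (signIsometry σ w) = w :=
  (signIsometry σ).toLinearEquiv.left_inv w

theorem det_signIsometry (σ : Fin d → ℤˣ) :
    LinearMap.det ((signIsometry σ).toLinearEquiv : Space d →ₗ[ℝ] Space d) =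
      ((∏ i, σ i : ℤˣ) : ℤ) := by
  rw [← LinearMap.det_toMatrix (EuclideanSpace.basisFun (Fin d) ℝ).toBasis]
  have : LinearMap.toMatrix (EuclideanSpace.basisFun (Fin d) ℝ).toBasis
      (EuclideanSpace.basisFun (Fin d) ℝ).toBasis
      ((signIsometry σ).toLinearEquiv : Space d →ₗ[ℝ] Space d) =
      Matrix.diagonal fun i => ((σ i : ℤ) : ℝ) := by
    ext i j
    by_cases h : i = j
    · subst h
      simp [LinearMap.toMatrix_apply, signIsometry_apply]
    · simp [LinearMap.toMatrix_apply, signIsometry_apply, h]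
  rw [this, Matrix.det_diagonal]
  push_cast
  rfl

variable (S p) in
/-- The tile of the reference corona lying in the orthant given by `b : Fin d → {-1, 0}`. -/
def refTile (b : Fin d → ℤ) : Set (Space d) :=
  {w | ∀ i, (b i : ℝ) ≤ w i - (if i ∈ S then max (w (p i)) 0 else 0) ∧
    w i - (if i ∈ S then max (w (p i)) 0 else 0) ≤ b i + 1}

variable (S p) in
/-- The reference corona: every vertex corona is an image of it. -/
def refCorona : Space d × Set (Set (Space d)) :=
  (0, refTile S p '' {b | ∀ i, b i = -1 ∨ b i = 0})

/-- By `hσ` the reflections turn the local profile into `max u 0`. Reflecting `[b, b + 1]` gives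
`[-1 - b, -b]`, hence the corner `-1 - b` in `hn`. -/
theorem image_refTile (hp : ∀ i ∈ S, p i ∉ S) {x : Space d} {z : Fin d → ℤ}
    (hz : ∀ i, cubeCoord S p x i = z i) {σ : Fin d → ℤˣ}
    (hσ : ∀ i ∈ S, ∀ u : ℝ, |u| ≤ 1 → ramp (x (p i) + ((σ (p i) : ℤ) : ℝ) * u) =
      ramp (x (p i)) + ((σ i : ℤ) : ℝ) * max u 0)
    {b n : Fin d → ℤ} (hb : ∀ i, b i = -1 ∨ b i = 0)
    (hn : ∀ i, n i = z i + if σ i = 1 then b i else -1 - b i) :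
    (fun w => x + signIsometry σ w) '' refTile S p b = tile S p n := by
  have unsheared (w : Space d) {j : Fin d} (hj : j ∉ S) :
      ((n j : ℝ) ≤ cubeCoord S p (x + signIsometry σ w) j ∧
        cubeCoord S p (x + signIsometry σ w) j ≤ n j + 1) ↔
      ((b j : ℝ) ≤ w j ∧ w j ≤ b j + 1) := by
    have hx := hz j
    rw [cubeCoord_of_notMem hj] at hx ⊢
    rw [hn, PiLp.add_apply, hx, signIsometry_apply]
    rcases Int.units_eq_one_or (σ j) with h | h
    · simp only [h, if_true]
      push_cast
      constructor <;> rintro ⟨_, _⟩ <;> constructor <;> linarith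
    · simp only [h, show (-1 : ℤˣ) ≠ 1 by decide, if_false]
      push_cast
      constructor <;> rintro ⟨_, _⟩ <;> constructor <;> linarith
  have key (w : Space d) (hw : ∀ j ∉ S, (b j : ℝ) ≤ w j ∧ w j ≤ b j + 1) :
      x + signIsometry σ w ∈ tile S p n ↔ w ∈ refTile S p b := by
    refine forall_congr' fun i => ?_
    by_cases hi : i ∈ S
    -- The local formula for the profile is valid only this close to the vertex.
    · have habs : |w (p i)| ≤ 1 := by
        have := hw (p i) (hp i hi)
        rw [abs_le]
        rcases hb (p i) with h | h <;> rw [h] at this <;> push_cast at this <;>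
          constructor <;> linarith
      have hx := hz i
      simp only [cubeCoord, hi, if_true, PiLp.add_apply, signIsometry_apply] at hx ⊢
      rw [hσ i hi _ habs, hn]
      rcases Int.units_eq_one_or (σ i) with h | h
      · simp only [h, if_true]
        push_cast
        constructor <;> rintro ⟨_, _⟩ <;> constructor <;> linarith
      · simp only [h, show (-1 : ℤˣ) ≠ 1 by decide, if_false]
        push_cast
        constructor <;> rintro ⟨_, _⟩ <;> constructor <;> linarith
    · rw [unsheared w hi]
      simp [hi]
  ext y
  constructor
  · rintro ⟨w, hw, rfl⟩
    exact (key w fun j hj => by simpa [hj] using hw j).2 hw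
  · intro hy
    obtain ⟨w, rfl⟩ : ∃ w, y = x + signIsometry σ w :=
      ⟨signIsometry σ (y - x), by rw [signIsometry_signIsometry]; abel⟩
    exact ⟨w, (key w fun j hj => (unsheared w hj).1 (hy j)).1 hy, rfl⟩

theorem vertexCorona_eq_moveCorona (hp : ∀ i ∈ S, p i ∉ S) {x : Space d} {z : Fin d → ℤ}
    (hz : ∀ i, cubeCoord S p x i = z i) {σ : Fin d → ℤˣ}
    (hσ : ∀ i ∈ S, ∀ u : ℝ, |u| ≤ 1 → ramp (x (p i) + ((σ (p i) : ℤ) : ℝ) * u) =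
      ramp (x (p i)) + ((σ i : ℤ) : ℝ) * max u 0) :
    vertexCorona (shearedTiling S p) x = moveCorona x (signIsometry σ) (refCorona S p) := by
  refine Prod.ext (by simp [vertexCorona, moveCorona, refCorona]) (Set.ext fun T => ?_)
  constructor
  · rintro ⟨⟨n, rfl⟩, hx⟩
    have hnz (i) : n i = z i - 1 ∨ n i = z i := by
      have := hx i
      rw [hz] at this
      norm_cast at this
      omega
    have hb (i) : (if σ i = 1 then n i - z i else z i - n i - 1) = -1 ∨
        (if σ i = 1 then n i - z i else z i - n i - 1) = 0 := by
      have := hnz i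
      split_ifs <;> omega
    refine ⟨_, ⟨fun i => if σ i = 1 then n i - z i else z i - n i - 1, hb, rfl⟩, ?_⟩
    refine image_refTile hp hz hσ hb fun i => ?_
    split_ifs <;> omega
  · rintro ⟨_, ⟨b, hb, rfl⟩, rfl⟩
    refine Set.mem_of_eq_of_mem (image_refTile hp hz hσ hb fun i => rfl) ?_
    refine ⟨⟨_, rfl⟩, fun i => ?_⟩
    rw [hz]
    have := hb i
    norm_cast
    dsimp only
    split_ifs <;> omega

theorem moveCorona_trans {C C' C₀ : Space d × Set (Set (Space d))} {t t' : Space d}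
    {R R' : Space d ≃ₗᵢ[ℝ] Space d} (h : C = moveCorona t R C₀) (h' : C' = moveCorona t' R' C₀) :
    C = moveCorona (t - R (R'.symm t')) (R'.symm.trans R) C' := by
  subst h h'
  have (a : Space d) : t - R (R'.symm t') + (R (R'.symm t') + R a) = t + R a := by abel
  simp [moveCorona, Set.image_image, this]

theorem exists_sign_of_isVertex (hp : ∀ i ∈ S, p i ∉ S) {x : Space d}
    (hx : IsVertex (shearedTiling S p) x) :
    ∃ (z : Fin d → ℤ) (σ : Fin d → ℤˣ), (∀ i, cubeCoord S p x i = z i) ∧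
      ∀ i ∈ S, ∀ u : ℝ, |u| ≤ 1 → ramp (x (p i) + ((σ (p i) : ℤ) : ℝ) * u) =
        ramp (x (p i)) + ((σ i : ℤ) : ℝ) * max u 0 := by
  obtain ⟨z, hz⟩ := exists_cubeCoord_eq_of_isVertex hp hx
  choose ε ρ h using exists_local_ramp
  -- Partners reflect the argument of the profile, sheared coordinates its value; disjointness of
  -- the two roles avoids any conflict.
  refine ⟨z, fun i => if i ∈ S then ε (z (p i)) else ρ (z i), hz, fun i hi u hu => ?_⟩
  have hxi := hz (p i)
  rw [cubeCoord_of_notMem (hp i hi)] at hxi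
  simpa only [hi, hp i hi, if_true, if_false, hxi] using h (z (p i)) u hu

theorem isMonocoronal_shearedTiling (hp : ∀ i ∈ S, p i ∉ S) :
    IsMonocoronal (shearedTiling S p) := by
  intro x y hx hy
  obtain ⟨z, σ, hz, hσ⟩ := exists_sign_of_isVertex hp hx
  obtain ⟨z', σ', hz', hσ'⟩ := exists_sign_of_isVertex hp hy
  exact ⟨_, _, moveCorona_trans (vertexCorona_eq_moveCorona hp hz hσ)
    (vertexCorona_eq_moveCorona hp hz' hσ')⟩

/-- A coordinate that is neither sheared nor a partner of a sheared one can be reflected, so that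
the vertex coronas are images of the reference corona under direct isometries. -/
theorem exists_moveCorona_of_isVertex (hp : ∀ i ∈ S, p i ∉ S) {o : Fin d} (ho : o ∉ S)
    (ho' : ∀ i ∈ S, p i ≠ o) {x : Space d} (hx : IsVertex (shearedTiling S p) x) :
    ∃ (t : Space d) (R : Space d ≃ₗᵢ[ℝ] Space d),
      LinearMap.det (R.toLinearEquiv : Space d →ₗ[ℝ] Space d) = 1 ∧
        vertexCorona (shearedTiling S p) x = moveCorona t R (refCorona S p) := by
  obtain ⟨z, σ, hz, hσ⟩ := exists_sign_of_isVertex hp hx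
  -- The extra factor at `o` squares the product of the signs, and `hσ` does not involve `o`.
  refine ⟨x, signIsometry fun i => σ i * if i = o then ∏ j, σ j else 1, ?_,
    vertexCorona_eq_moveCorona hp hz fun i hi u hu => ?_⟩
  · rw [det_signIsometry, Finset.prod_mul_distrib, Finset.prod_ite_eq' Finset.univ o,
      if_pos (Finset.mem_univ o), Int.units_mul_self]
    simp
  · have : i ≠ o := fun h => ho (h ▸ hi)
    simpa [this, ho' i hi] using hσ i hi u hu

theorem isMonocoronalRigid_shearedTiling (hp : ∀ i ∈ S, p i ∉ S) {o : Fin d} (ho : o ∉ S)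
    (ho' : ∀ i ∈ S, p i ≠ o) : IsMonocoronalRigid (shearedTiling S p) := by
  intro x y hx hy
  obtain ⟨t, R, hR, h⟩ := exists_moveCorona_of_isVertex hp ho ho' hx
  obtain ⟨t', R', hR', h'⟩ := exists_moveCorona_of_isVertex hp ho ho' hy
  refine ⟨_, _, ?_, moveCorona_trans h h'⟩
  have hsymm := R'.toLinearEquiv.det_symm_mul_det
  rw [hR', mul_one] at hsymm
  change LinearMap.det ((R.toLinearEquiv : Space d →ₗ[ℝ] Space d) ∘ₗ
    (R'.toLinearEquiv.symm : Space d →ₗ[ℝ] Space d)) = 1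
  rw [LinearMap.det_comp, hR, hsymm, one_mul]

/-! ### Translations -/

/-- No profile depends on a non-partner coordinate, so sheared axes are periods as well as free
ones. -/
theorem single_mem_translationVectors {i : Fin d} (hi : ∀ j ∈ S, p j ≠ i) :
    EuclideanSpace.single i (1 : ℝ) ∈ translationVectors (shearedTiling S p) := by
  have image_tile (n : Fin d → ℤ) : IsometryEquiv.addLeft (EuclideanSpace.single i (1 : ℝ)) ''
      tile S p n = tile S p (n + Pi.single i 1) := by
    have key (x : Space d) : EuclideanSpace.single i (1 : ℝ) + x ∈ tile S p (n + Pi.single i 1) ↔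
        x ∈ tile S p n := by
      refine forall_congr' fun j => ?_
      rw [add_comm (EuclideanSpace.single i 1) x, cubeCoord_add_single x 1 hi, Pi.add_apply, Pi.single_apply]
      split_ifs <;> push_cast <;> constructor <;> rintro ⟨_, _⟩ <;> constructor <;> linarith
    ext y
    constructor
    · rintro ⟨x, hx, rfl⟩
      exact (key x).2 hx
    · intro hy
      refine ⟨y - EuclideanSpace.single i 1, (key _).1 ?_, ?_⟩ <;> simp [hy]
  change _ '' Set.range (tile S p) = Set.range (tile S p)
  rw [← Set.range_comp]
  ext T
  constructor
  · rintro ⟨n, rfl⟩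
    exact ⟨_, (image_tile n).symm⟩
  · rintro ⟨n, rfl⟩
    exact ⟨n - Pi.single i 1, (image_tile _).trans (by rw [sub_add_cancel])⟩

/-- A translation from one tile to another one respects the positions of the two faces on which the
partner of a sheared coordinate is constant. -/
theorem apply_eq_of_image_tile (hp : ∀ i ∈ S, p i ∉ S) {v : Space d} {n n' : Fin d → ℤ}
    (h : (fun x => v + x) '' tile S p n = tile S p n') {i : Fin d} (hi : i ∈ S) (t : ℤ)
    (ht : t = 0 ∨ t = 1) :
    v (p i) = n' (p i) - n (p i) ∧
    v i = n' i - n i + height (n' (p i) + t) - height (n (p i) + t) := by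
  -- Testing one corner gives lower bounds; applied to `v` and to `-v` they become equalities.
  have lower {v : Space d} {n n' : Fin d → ℤ} (h : ∀ x ∈ tile S p n, v + x ∈ tile S p n') (t : ℤ)
      (ht : t = 0 ∨ t = 1) : (n' (p i) : ℝ) ≤ v (p i) + (n (p i) + t) ∧
      (n' i : ℝ) ≤ v i + (n i + ramp (n (p i) + t)) - ramp (v (p i) + (n (p i) + t)) := by
    let w : Fin d → ℝ := fun j => n j + if j = p i then (t : ℝ) else 0
    have hw : ofCubeCoord S p w ∈ tile S p n := fun j => by
      rw [cubeCoord_ofCubeCoord hp]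
      simp only [w]
      split_ifs <;> rcases ht with rfl | rfl <;> simp
    have hne : i ≠ p i := fun h => hp i hi (h ▸ hi)
    have h₁ := (h _ hw (p i)).1
    have h₂ := (h _ hw i).1
    simp only [cubeCoord, hi, hp i hi, if_true, if_false, PiLp.add_apply, ofCubeCoord, w, hne,
      add_zero, sub_zero] at h₁ h₂
    exact ⟨h₁, h₂⟩
  have hforth : ∀ x ∈ tile S p n, v + x ∈ tile S p n' := fun x hx => h ▸ ⟨x, hx, rfl⟩
  have hback : ∀ x ∈ tile S p n', -v + x ∈ tile S p n := fun x hx => by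
    obtain ⟨y, hy, rfl⟩ := h.symm ▸ hx
    simpa using hy
  have hv : v (p i) = n' (p i) - n (p i) := by
    have h₁ := (lower hforth 0 (.inl rfl)).1
    have h₂ := (lower hback 0 (.inl rfl)).1
    simp only [PiLp.neg_apply, Int.cast_zero, add_zero] at h₁ h₂
    linarith
  refine ⟨hv, ?_⟩
  have h₁ := (lower hforth t ht).2
  have h₂ := (lower hback t ht).2
  rw [PiLp.neg_apply, PiLp.neg_apply] at h₂
  rw [show v (p i) + (n (p i) + t) = ((n' (p i) + t : ℤ) : ℝ) by rw [hv]; push_cast; ring,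
    ← Int.cast_add, ramp_intCast, ramp_intCast] at h₁
  rw [show -v (p i) + (n' (p i) + t) = ((n (p i) + t : ℤ) : ℝ) by rw [hv]; push_cast; ring,
    ← Int.cast_add, ramp_intCast, ramp_intCast] at h₂
  linarith

/-- Subtracting the cases `t = 0` and `t = 1` of `apply_eq_of_image_tile` shows that `v (p i)` is a
period of `slope`. -/
theorem apply_eq_zero_of_mem_translationVectors (hp : ∀ i ∈ S, p i ∉ S) {v : Space d}
    (hv : v ∈ translationVectors (shearedTiling S p)) {i : Fin d} (hi : i ∈ S) : v (p i) = 0 := by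
  have h (n : Fin d → ℤ) : ∃ n', (fun x => v + x) '' tile S p n = tile S p n' := by
    have : (fun x => v + x) '' tile S p n ∈ shearedTiling S p := by
      rw [← show _ = shearedTiling S p from hv]
      exact ⟨_, ⟨n, rfl⟩, rfl⟩
    obtain ⟨n', h⟩ := this
    exact ⟨n', h.symm⟩
  choose f hf using h
  have h₁ (j : ℤ) := apply_eq_of_image_tile hp (hf fun _ => j) hi 0 (.inl rfl)
  have h₂ (j : ℤ) := (apply_eq_of_image_tile hp (hf fun _ => j) hi 1 (.inr rfl)).2
  obtain ⟨V, hV⟩ : ∃ V : ℤ, v (p i) = V := ⟨_, by simpa using (h₁ 0).1⟩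
  rw [hV, eq_zero_of_slope_periodic (v := V) fun j => ?_, Int.cast_zero]
  have h₃ := h₂ j
  obtain ⟨h₄, h₅⟩ := h₁ j
  rw [hV] at h₄
  have h₆ : f (fun _ => j) (p i) = j + V := by
    have : (f (fun _ => j) (p i) : ℝ) = j + V := by linarith
    exact_mod_cast this
  rw [h₆] at h₃ h₅
  rw [h₃] at h₅
  simp only [add_zero] at h₅
  have h₇ : (height (j + V + 1) : ℝ) - height (j + V) = height (j + 1) - height j := by linarith
  exact_mod_cast h₇

theorem isPeriodic_shearedTiling (hp : ∀ i ∈ S, p i ∉ S) :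
    IsPeriodic (d - (S.image p).card) (shearedTiling S p) := by
  let b : {i // i ∉ S.image p} → Space d := fun i => EuclideanSpace.single i.1 1
  have hspan : Submodule.span ℝ (translationVectors (shearedTiling S p)) =
      Submodule.span ℝ (Set.range b) := by
    apply le_antisymm
    · rw [Submodule.span_le]
      intro v hv
      have hsum : v = ∑ i, v i • EuclideanSpace.single i (1 : ℝ) := by
        simpa using ((EuclideanSpace.basisFun (Fin d) ℝ).sum_repr v).symm
      rw [hsum]
      refine Submodule.sum_mem _ fun i _ => ?_
      by_cases hi : i ∈ S.image p
      · obtain ⟨j, hj, rfl⟩ := Finset.mem_image.1 hi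
        rw [apply_eq_zero_of_mem_translationVectors hp hv hj, zero_smul]
        exact Submodule.zero_mem _
      · exact Submodule.smul_mem _ _ (Submodule.subset_span ⟨⟨i, hi⟩, rfl⟩)
    · rw [Submodule.span_le]
      rintro _ ⟨⟨i, hi⟩, rfl⟩
      exact Submodule.subset_span (single_mem_translationVectors fun j hj h =>
        hi (Finset.mem_image.2 ⟨j, hj, h⟩))
  have hb : LinearIndependent ℝ b := by
    have := (EuclideanSpace.basisFun (Fin d) ℝ).toBasis.linearIndependent.comp
      (Subtype.val : {i // i ∉ S.image p} → Fin d) Subtype.val_injective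
    rwa [show (EuclideanSpace.basisFun (Fin d) ℝ).toBasis ∘ Subtype.val = b by ext1 i; simp [b]]
      at this
  rw [IsPeriodic, hspan, finrank_span_eq_card hb, Fintype.card_subtype_compl,
    Fintype.card_coe, Fintype.card_fin]

end Sheared

/-! ### Choice of the pairing and the final count -/

/-- For `2k ≤ d`, pairing the coordinates `i` and `i + k` for `i < k` gives a tiling with `d - k`
independent translations. If `2k < d`, then the last coordinate is free. -/
theorem exists_tiling {d k : ℕ} (hk : 2 * k ≤ d) :
    ∃ 𝒯 : Set (Set (Space d)), IsTiling 𝒯 ∧ IsFaceToFace 𝒯 ∧ IsMonocoronal 𝒯 ∧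
      IsPeriodic (d - k) 𝒯 ∧ (2 * k < d → IsMonocoronalRigid 𝒯) := by
  let S : Finset (Fin d) := {i | (i : ℕ) < k}
  let p : Fin d → Fin d := fun i => if h : (i : ℕ) < k then ⟨i + k, by omega⟩ else i
  have hS (i : Fin d) : i ∈ S ↔ (i : ℕ) < k := by simp [S]
  have hval (i : Fin d) (hi : i ∈ S) : (p i : ℕ) = i + k := by simp [p, (hS i).1 hi]
  have hp : ∀ i ∈ S, p i ∉ S := fun i hi => by
    rw [hS, hval i hi]
    omega
  have hcard : (S.image p).card = k := by
    rw [Finset.card_image_of_injOn, Fin.card_filter_val_lt]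
    · omega
    · intro i hi j hj h
      have := congrArg Fin.val h
      rw [hval i hi, hval j hj] at this
      exact Fin.ext (by omega)
  refine ⟨shearedTiling S p, isTiling_shearedTiling hp, isFaceToFace_shearedTiling hp,
    isMonocoronal_shearedTiling hp, ?_, fun hlt => ?_⟩
  · simpa only [hcard] using isPeriodic_shearedTiling hp
  · refine isMonocoronalRigid_shearedTiling hp (o := ⟨d - 1, by omega⟩) ?_ fun i hi h => ?_
    · rw [hS]
      simp only
      omega
    · have h₁ := congrArg Fin.val h
      have h₂ := (hS i).1 hi
      rw [hval i hi] at h₁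
      simp only at h₁
      omega

end MonoTiling

theorem theorem3p1 (d : ℕ) (hd : 1 ≤ d) :
    (∃ 𝒯 : Set (Set (MonoTiling.Space d)),
      MonoTiling.IsTiling 𝒯 ∧ MonoTiling.IsFaceToFace 𝒯 ∧ MonoTiling.IsMonocoronal 𝒯 ∧
        MonoTiling.IsPeriodic ⌈(d : ℚ) / 2⌉₊ 𝒯) ∧
    (∃ 𝒯 : Set (Set (MonoTiling.Space d)),
      MonoTiling.IsTiling 𝒯 ∧ MonoTiling.IsFaceToFace 𝒯 ∧ MonoTiling.IsMonocoronalRigid 𝒯 ∧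
        MonoTiling.IsPeriodic ⌈((d : ℚ) + 1) / 2⌉₊ 𝒯) := by
  have ceil_half (n : ℕ) : ⌈(n : ℚ) / 2⌉₊ = n - n / 2 := by
    have h₁ : n / 2 + (n - n / 2) = n := by omega
    have h₂ : n / 2 ≤ n - n / 2 ∧ n - n / 2 ≤ n / 2 + 1 := by omega
    rw [← Nat.cast_inj (R := ℤ), Int.natCast_ceil_eq_ceil (by positivity), Int.ceil_eq_iff]
    generalize n / 2 = a at *
    generalize n - a = b at *
    have h₁' : (a : ℚ) + b = n := by exact_mod_cast h₁
    have h₂' : (a : ℚ) ≤ b := by exact_mod_cast h₂.1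
    have h₃' : (b : ℚ) ≤ a + 1 := by exact_mod_cast h₂.2
    push_cast
    constructor <;> linarith
  have h₁ := ceil_half d
  have h₂ := ceil_half (d + 1)
  -- `(d - 1) / 2` is the largest `k` with `2 * k < d`, so a coordinate stays free.
  rw [Nat.cast_succ, show d + 1 - (d + 1) / 2 = d - (d - 1) / 2 by omega] at h₂
  rw [h₁, h₂]
  obtain ⟨𝒯, ht, hf, hm, hper, -⟩ := MonoTiling.exists_tiling (d := d) (k := d / 2) (by omega)
  obtain ⟨𝒯', ht', hf', -, hper', hm'⟩ :=
    MonoTiling.exists_tiling (d := d) (k := (d - 1) / 2) (by omega)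
  exact ⟨⟨𝒯, ht, hf, hm, hper⟩, ⟨𝒯', ht', hf', hm' (by omega), hper'⟩⟩
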